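/- Let $n\ge 1$ and $T>0$, and put $I=[0,T]$, $J=[0,2T]$. Let $a_0,\dots,a_{2n-1}\in L^1(I)$ be real-valued and let $$Lu(t)=u^{(2n)}(t)+a_{2n-1}(t)u^{(2n-1)}(t)+\dots+a_1(t)u'(t)+a_0(t)u(t),\qquad t\in I.$$ Let $\widetilde L$ be the operator of the same form on $J$ whose coefficients are the extensions of the $a_k$ to $J$ by reflection with respect to $t=T$, even for even $k$ and odd for odd $k$; that is, $\tilde a_k(t)=a_k(t)$ for $t\in[0,T]$ and $\tilde a_k(t)=(-1)^k a_k(2T-t)$ for $t\in(T,2T]$. For an interval $K$ let $W^{2n,1}(K)$ be the set of $u\in C^{2n-1}(K)$ with $u^{(2n-1)}$ absolutely continuous on $K$, and let $$X_{D,T}=\{u\in W^{2n,1}(I): u^{(2k)}(0)=u^{(2k)}(T)=0,\ k=0,\dots,n-1\},$$ $$X_{M_2,T}=\{u\in W^{2n,1}(I): u^{(2k)}(0)=u^{(2k+1)}(T)=0,\ k=0,\dots,n-1\},$$ $$X_{D,2T}=\{u\in W^{2n,1}(J): u^{(2k)}(0)=u^{(2k)}(2T)=0,\ k=0,\dots,n-1\}.$$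 Assume that $L$ is nonresonant in $X_{D,T}$ and in $X_{M_2,T}$ and that $\widetilde L$ is nonresonant in $X_{D,2T}$ (an operator is nonresonant in a space if the homogeneous equation, required almost everywhere, has only the trivial solution in that space). Let $G_D[2T]$ be the Green's function of $\widetilde L$ on $X_{D,2T}$, i.e. the unique continuous function on $J\times J$ such that, for every $\sigma\in L^1(J)$, the unique solution $u\in X_{D,2T}$ of $\widetilde Lu=\sigma$ a.e. on $J$ is $u(t)=\int_0^{2T}G_D[2T](t,s)\,\sigma(s)\,ds$, $t\in J$. Let $\sigma_1,\sigma_2\in L^1(I)$, let $u_{M_2}$ be the unique solution of $Lu=\sigma_1$ a.e. on $I$, $u\in X_{M_2,T}$ (Mixed problem 2), and let $u_D$ be the unique solution of $Lu=\sigma_2$ a.e. on $I$, $u\in X_{D,T}$ (Dirichlet problem). Then: 1. If $G_D[2T]\ge 0$ on $J\times J$ and $|\sigma_2(t)|\le\sigma_1(t)$ for a.e. $t\in I$, then $|u_D(t)|\le u_{M_2}(t)$ for all $t\in I$. 2. If $G_D[2T]\le 0$ on $J\times J$ and $0\le\sigma_2(t)\le\sigma_1(t)$ for a.e. $t\in I$,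 then $u_{M_2}(t)\le 0$ and $u_{M_2}(t)\le u_D(t)$ for all $t\in I$. 3. If $G_D[2T]\le 0$ on $J\times J$ and $\sigma_1(t)\le\sigma_2(t)\le 0$ for a.e. $t\in I$, then $u_{M_2}(t)\ge 0$ and $u_D(t)\le u_{M_2}(t)$ for all $t\in I$. -/

import Mathlib

open MeasureTheory Set

namespace BVP

/-- The Sobolev space `W^{m,1}([0,T])` (for `m ≥ 1`): functions of class `C^{m-1}` on `[0,T]` whose
derivative of order `m - 1` is absolutely continuous on `[0,T]`. Only the values of `u` on `[0,T]`
matter; derivatives at the end points are one-sided. -/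
def sobolevW (m : ℕ) (T : ℝ) : Set (ℝ → ℝ) :=
  {u | ContDiffOn ℝ (m - 1 : ℕ) u (Icc 0 T) ∧
    AbsolutelyContinuousOnInterval (iteratedDerivWithin (m - 1) u (Icc 0 T)) 0 T}

/-- The linear operator `u^{(m)} + a_{m-1} u^{(m-1)} + ⋯ + a_1 u' + a_0 u` of order `m` on
`[0,T]`. -/
noncomputable def diffOp {m : ℕ} (T : ℝ) (a : Fin m → ℝ → ℝ) (u : ℝ → ℝ) (t : ℝ) : ℝ :=
  iteratedDerivWithin m u (Icc 0 T) t +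
    ∑ k : Fin m, a k t * iteratedDerivWithin (k : ℕ) u (Icc 0 T) t

/-- The extensions to `[0,2T]` of the coefficients, by reflection with respect to `t = T`:
the even extension for even indices and the odd extension for odd indices. -/
noncomputable def extendCoeff {m : ℕ} (T : ℝ) (a : Fin m → ℝ → ℝ) (k : Fin m) (t : ℝ) : ℝ :=
  if t ≤ T then a k t else (-1) ^ (k : ℕ) * a k (2 * T - t)

/-- The space `X_{D,T}` of the Dirichlet problem on `[0,T]`:
`u^{(2k)}(0) = u^{(2k)}(T) = 0` for `k = 0, …, n - 1`. -/
def dirichletSpace (n : ℕ) (T : ℝ) : Set (ℝ → ℝ) :=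
  {u | u ∈ sobolevW (2 * n) T ∧ ∀ k < n,
    iteratedDerivWithin (2 * k) u (Icc 0 T) 0 = 0 ∧
    iteratedDerivWithin (2 * k) u (Icc 0 T) T = 0}

/-- The space `X_{M₂,T}` of the Mixed problem 2 on `[0,T]`:
`u^{(2k)}(0) = u^{(2k+1)}(T) = 0` for `k = 0, …, n - 1`. -/
def mixed2Space (n : ℕ) (T : ℝ) : Set (ℝ → ℝ) :=
  {u | u ∈ sobolevW (2 * n) T ∧ ∀ k < n,
    iteratedDerivWithin (2 * k) u (Icc 0 T) 0 = 0 ∧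
    iteratedDerivWithin (2 * k + 1) u (Icc 0 T) T = 0}

/-- `u` solves the problem `L u(t) = σ(t)` for a.e. `t ∈ [0,T]`, `u ∈ X`. -/
def IsSolution {m : ℕ} (T : ℝ) (a : Fin m → ℝ → ℝ) (X : Set (ℝ → ℝ)) (σ u : ℝ → ℝ) : Prop :=
  u ∈ X ∧ ∀ᵐ t ∂(volume.restrict (Icc 0 T)), diffOp T a u t = σ t

/-- `L` is nonresonant in `X`: the homogeneous problem has only the trivial solution. -/
def Nonresonant {m : ℕ} (T : ℝ) (a : Fin m → ℝ → ℝ) (X : Set (ℝ → ℝ)) : Prop :=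
  ∀ u : ℝ → ℝ, IsSolution T a X (fun _ => 0) u → ∀ t ∈ Icc 0 T, u t = 0

/-- `G` is the Green's function of the operator with coefficients `a` on the space `X` of functions
on `[0,T]` (order at least two): it is continuous on `[0,T] × [0,T]` and, for every
`σ ∈ L¹([0,T])`, the one and only solution (as a function on `[0,T]`) of `L u = σ` a.e., `u ∈ X`, is
`u(t) = ∫₀ᵀ G(t,s) σ(s) ds`. The continuity makes the values of `G` on the whole square unique. -/
structure IsGreenFunction {m : ℕ} (T : ℝ) (a : Fin m → ℝ → ℝ) (X : Set (ℝ → ℝ))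
    (G : ℝ → ℝ → ℝ) : Prop where
  continuousOn : ContinuousOn (fun p : ℝ × ℝ => G p.1 p.2) (Icc 0 T ×ˢ Icc 0 T)
  isSolution_iff : ∀ σ : ℝ → ℝ, IntegrableOn σ (Icc 0 T) → ∀ u : ℝ → ℝ,
    IsSolution T a X σ u ↔ ∀ t ∈ Icc 0 T, u t = ∫ s in (0 : ℝ)..T, G t s * σ s

end BVP

namespace BVP

/-! Both problems on `[0,T]` are restrictions of one Dirichlet problem on `[0,2T]`. Reflect `uM`
evenly and `uD` oddly about `T`. The conditions at `T` are exactly what makes the reflected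
functions regular there, and the parities of the extended coefficients make them solve the doubled
equation with the data `σ₁`, `σ₂` reflected evenly and oddly (`isSolution_reflectExt`). Hence `uM`
and `uD` are integrals of the same kernel `G` against the reflected data. These can be compared
pointwise: at each point they are `x` and `±y`, with `x`, `y` the values of `σ₁`, `σ₂` at one common
point. The sign of `G` carries the comparison over to the integrals. -/

/-! ### Absolute continuity under reflection and gluing. -/

/-- Reflection, congruence and gluing below all reduce to operations on an integrable derivative
through this criterion. -/
theorem absolutelyContinuousOnInterval_of_eq_integral {f h : ℝ → ℝ} {a b C : ℝ}
    (hh : IntervalIntegrable h volume a b) (hf : ∀ x ∈ uIcc a b, f x = C + ∫ s in a..x, h s) :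
    AbsolutelyContinuousOnInterval f a b := by
  have h1 := hh.absolutelyContinuousOnInterval_intervalIntegral left_mem_uIcc
  rw [absolutelyContinuousOnInterval_iff] at h1 ⊢
  intro ε hε
  obtain ⟨δ, hδ, h2⟩ := h1 ε hε
  refine ⟨δ, hδ, fun E hE hEδ => ?_⟩
  convert h2 E hE hEδ using 1
  refine Finset.sum_congr rfl fun i hi => ?_
  obtain ⟨h3, h4⟩ := hE.1 i hi
  rw [hf _ h3, hf _ h4, dist_add_left]

theorem integral_deriv_of_mem {f : ℝ → ℝ} {a b x : ℝ}
    (hf : AbsolutelyContinuousOnInterval f a b) (hx : x ∈ uIcc a b) :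
    ∫ s in a..x, deriv f s = f x - f a :=
  (hf.mono (uIcc_subset_uIcc left_mem_uIcc hx)).integral_deriv_eq_sub

theorem _root_.AbsolutelyContinuousOnInterval.comp_const_sub {f : ℝ → ℝ} {a b : ℝ} (c : ℝ)
    (hf : AbsolutelyContinuousOnInterval f a b) :
    AbsolutelyContinuousOnInterval (fun x => f (c - x)) (c - a) (c - b) := by
  have h := hf.intervalIntegrable_deriv
  refine absolutelyContinuousOnInterval_of_eq_integral (h := fun s => -deriv f (c - s))
    (C := f a) ?_ fun x hx => ?_
  · exact (h.comp_sub_left c).neg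
  · have hx' : c - x ∈ uIcc a b := by
      rw [mem_uIcc] at hx ⊢
      rcases hx with hx | hx
      · right; constructor <;> linarith [hx.1, hx.2]
      · left; constructor <;> linarith [hx.1, hx.2]
    rw [intervalIntegral.integral_neg, intervalIntegral.integral_comp_sub_left (deriv f),
      sub_sub_cancel, intervalIntegral.integral_symm, integral_deriv_of_mem hf hx']
    ring

theorem _root_.AbsolutelyContinuousOnInterval.congr {f g : ℝ → ℝ} {a b : ℝ}
    (hf : AbsolutelyContinuousOnInterval f a b) (hfg : ∀ x ∈ uIcc a b, g x = f x) :
    AbsolutelyContinuousOnInterval g a b :=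
  absolutelyContinuousOnInterval_of_eq_integral hf.intervalIntegrable_deriv fun x hx => by
    rw [hfg x hx, integral_deriv_of_mem hf hx, add_sub_cancel]

theorem _root_.AbsolutelyContinuousOnInterval.trans {f : ℝ → ℝ} {a b c : ℝ} (hab : a ≤ b)
    (hbc : b ≤ c) (h₁ : AbsolutelyContinuousOnInterval f a b)
    (h₂ : AbsolutelyContinuousOnInterval f b c) : AbsolutelyContinuousOnInterval f a c := by
  refine absolutelyContinuousOnInterval_of_eq_integral (h := deriv f) (C := f a)
    (h₁.intervalIntegrable_deriv.trans h₂.intervalIntegrable_deriv) fun x hx => ?_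
  rw [uIcc_of_le (hab.trans hbc)] at hx
  rcases le_total x b with hxb | hxb
  · rw [integral_deriv_of_mem h₁ (by rw [uIcc_of_le hab]; exact ⟨hx.1, hxb⟩)]
    ring
  · have hx' : x ∈ uIcc b c := by rw [uIcc_of_le hbc]; exact ⟨hxb, hx.2⟩
    rw [← intervalIntegral.integral_add_adjacent_intervals h₁.intervalIntegrable_deriv
      (h₂.mono (uIcc_subset_uIcc left_mem_uIcc hx')).intervalIntegrable_deriv,
      integral_deriv_of_mem h₁ right_mem_uIcc, integral_deriv_of_mem h₂ hx']
    ring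

/-! ### Reflection about `T` and its regularity. -/

/-- The extension of `f` from `[0,T]` to `[0,2T]` by reflection with respect to `T`:
even for `ε = 1` and odd for `ε = -1`. -/
noncomputable def reflectExt (T ε : ℝ) (f : ℝ → ℝ) (t : ℝ) : ℝ :=
  if t ≤ T then f t else ε * f (2 * T - t)

theorem reflectExt_of_le {T ε t : ℝ} {f : ℝ → ℝ} (ht : t ≤ T) : reflectExt T ε f t = f t :=
  if_pos ht

theorem reflectExt_of_lt {T ε t : ℝ} {f : ℝ → ℝ} (ht : T < t) :
    reflectExt T ε f t = ε * f (2 * T - t) :=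
  if_neg ht.not_ge

theorem reflectExt_of_ge {T ε t : ℝ} {f : ℝ → ℝ} (hf : f T = ε * f T) (ht : T ≤ t) :
    reflectExt T ε f t = ε * f (2 * T - t) := by
  rcases ht.eq_or_lt with rfl | ht
  · rw [reflectExt_of_le le_rfl, show 2 * T - T = T by ring, ← hf]
  · exact reflectExt_of_lt ht

theorem absolutelyContinuousOnInterval_reflectExt {T ε : ℝ} {f : ℝ → ℝ} (hT : 0 < T)
    (hf : AbsolutelyContinuousOnInterval f 0 T) (hfT : f T = ε * f T) :
    AbsolutelyContinuousOnInterval (reflectExt T ε f) 0 (2 * T) := by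
  refine AbsolutelyContinuousOnInterval.trans hT.le (by linarith : T ≤ 2 * T) ?_ ?_
  · refine hf.congr fun x hx => ?_
    rw [uIcc_of_le hT.le] at hx
    exact reflectExt_of_le hx.2
  · have h := ((hf.comp_const_sub (2 * T)).const_mul ε).symm
    rw [sub_zero, show 2 * T - T = T by ring] at h
    refine h.congr fun x hx => ?_
    rw [uIcc_of_le (by linarith)] at hx
    exact reflectExt_of_ge hfT hx.1

/-- Differentiation flips the parity. At `T` the two one-sided derivatives are glued: `hfT` makes
the values match, `hfT'` the slopes. -/
theorem hasDerivWithinAt_reflectExt {T ε : ℝ} {f f' : ℝ → ℝ}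
    (hf : ∀ t ∈ Icc 0 T, HasDerivWithinAt f (f' t) (Icc 0 T) t)
    (hfT : f T = ε * f T) (hfT' : f' T = -ε * f' T) {t : ℝ} (ht : t ∈ Icc 0 (2 * T)) :
    HasDerivWithinAt (reflectExt T ε f) (reflectExt T (-ε) f' t) (Icc 0 (2 * T)) t := by
  have hl : ∀ t ∈ Icc 0 T,
      HasDerivWithinAt (reflectExt T ε f) (reflectExt T (-ε) f' t) (Icc 0 T) t := by
    intro t ht
    rw [reflectExt_of_le ht.2]
    exact (hf t ht).congr (fun x hx => reflectExt_of_le hx.2) (reflectExt_of_le ht.2)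
  have hr : ∀ t ∈ Icc T (2 * T),
      HasDerivWithinAt (reflectExt T ε f) (reflectExt T (-ε) f' t) (Icc T (2 * T)) t := by
    intro t ht
    rw [reflectExt_of_ge hfT' ht.1]
    have h1 : MapsTo (fun x => 2 * T - x) (Icc T (2 * T)) (Icc 0 T) := fun x hx =>
      ⟨by linarith [hx.2], by linarith [hx.1]⟩
    have h2 := ((hf _ (h1 ht)).comp t ((hasDerivWithinAt_id t _).const_sub (2 * T)) h1).const_mul ε
    refine (h2.congr (fun x hx => reflectExt_of_ge hfT hx.1)
      (reflectExt_of_ge hfT ht.1)).congr_deriv ?_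
    ring
  rcases lt_trichotomy t T with h | rfl | h
  · refine (hl t ⟨ht.1, h.le⟩).mono_of_mem_nhdsWithin ?_
    exact mem_nhdsWithin.2 ⟨Iio T, isOpen_Iio, h, fun x hx => ⟨hx.2.1, le_of_lt hx.1⟩⟩
  · have h0 : 0 ≤ t := ht.1
    have := (hl t ⟨h0, le_rfl⟩).union (hr t ⟨le_rfl, ht.2⟩)
    rwa [Icc_union_Icc_eq_Icc h0 ht.2] at this
  · refine (hr t ⟨h.le, ht.2⟩).mono_of_mem_nhdsWithin ?_
    exact mem_nhdsWithin.2 ⟨Ioi T, isOpen_Ioi, h, fun x hx => ⟨le_of_lt hx.1, hx.2.2⟩⟩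

theorem continuousOn_reflectExt {T ε : ℝ} {f : ℝ → ℝ} (hT : 0 < T)
    (hf : ContinuousOn f (Icc 0 T)) (hfT : f T = ε * f T) :
    ContinuousOn (reflectExt T ε f) (Icc 0 (2 * T)) := by
  rw [← Icc_union_Icc_eq_Icc hT.le (by linarith : T ≤ 2 * T)]
  refine ContinuousOn.union_of_isClosed ?_ ?_ isClosed_Icc isClosed_Icc
  · exact hf.congr fun x hx => reflectExt_of_le hx.2
  · refine (continuousOn_const.mul (hf.comp (continuousOn_const.sub continuousOn_id)
      fun x hx => ?_)).congr fun x hx => reflectExt_of_ge hfT hx.1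
    exact ⟨by simpa using hx.2, by simp; linarith [hx.1]⟩

/-- Compatibility at `T` of the derivatives of order at most `m` with the reflection. -/
def Compatible (m : ℕ) (T ε : ℝ) (u : ℝ → ℝ) : Prop :=
  ∀ k ≤ m, iteratedDerivWithin k u (Icc 0 T) T =
    ((-1) ^ k * ε) * iteratedDerivWithin k u (Icc 0 T) T

theorem iteratedDerivWithin_reflectExt {m : ℕ} {T ε : ℝ} {u : ℝ → ℝ} (hT : 0 < T)
    (hu : ContDiffOn ℝ m u (Icc 0 T)) (hc : Compatible m T ε u) {k : ℕ} (hk : k ≤ m) :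
    EqOn (iteratedDerivWithin k (reflectExt T ε u) (Icc 0 (2 * T)))
      (reflectExt T ((-1) ^ k * ε) (iteratedDerivWithin k u (Icc 0 T))) (Icc 0 (2 * T)) := by
  induction k with
  | zero =>
    intro t ht
    simp [iteratedDerivWithin_zero]
  | succ k ih =>
    intro t ht
    rw [iteratedDerivWithin_succ,
      derivWithin_congr (ih (by lia)) (ih (by lia) ht)]
    have hd := hasDerivWithinAt_reflectExt (T := T) (ε := (-1) ^ k * ε)
      (f := iteratedDerivWithin k u (Icc 0 T)) (f' := iteratedDerivWithin (k + 1) u (Icc 0 T))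
      (fun t ht => by
        rw [iteratedDerivWithin_succ]
        exact (hu.differentiableOn_iteratedDerivWithin (by exact_mod_cast hk)
          (uniqueDiffOn_Icc hT) t ht).hasDerivWithinAt)
      (hc k (by lia)) (by simpa [pow_succ] using hc (k + 1) hk) ht
    rw [hd.derivWithin (uniqueDiffOn_Icc (by linarith) t ht)]
    congr 1
    ring

theorem reflectExt_mem_sobolevW {m : ℕ} {T ε : ℝ} {u : ℝ → ℝ} (hT : 0 < T)
    (hu : u ∈ sobolevW m T) (hc : Compatible (m - 1) T ε u) :
    reflectExt T ε u ∈ sobolevW m (2 * T) := by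
  obtain ⟨h1, h2⟩ := hu
  have hI := fun {k} => iteratedDerivWithin_reflectExt (k := k) hT h1 hc
  refine ⟨?_, ?_⟩
  · refine contDiffOn_of_continuousOn_differentiableOn_deriv (n := ((m - 1 : ℕ) : ℕ∞)) ?_ ?_
    · intro k hk
      have hk' : k ≤ m - 1 := by exact_mod_cast hk
      exact (continuousOn_reflectExt hT (h1.continuousOn_iteratedDerivWithin
        (by exact_mod_cast hk') (uniqueDiffOn_Icc hT)) (hc k hk')).congr (hI hk')
    · intro k hk
      have hk' : k < m - 1 := by exact_mod_cast hk
      refine DifferentiableOn.congr (f := reflectExt T ((-1) ^ k * ε)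
        (iteratedDerivWithin k u (Icc 0 T))) (fun t ht => ?_) (hI hk'.le)
      refine (hasDerivWithinAt_reflectExt (f' := iteratedDerivWithin (k + 1) u (Icc 0 T))
        (fun t ht => ?_) (hc k hk'.le) (by simpa [pow_succ] using hc (k + 1) hk')
        ht).differentiableWithinAt
      rw [iteratedDerivWithin_succ]
      exact (h1.differentiableOn_iteratedDerivWithin (by exact_mod_cast hk')
          (uniqueDiffOn_Icc hT) t ht).hasDerivWithinAt
  · refine (absolutelyContinuousOnInterval_reflectExt hT h2 (hc _ le_rfl)).congr fun x hx => ?_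
    rw [uIcc_of_le (by linarith)] at hx
    exact hI le_rfl hx

/-- Reflection carries the conditions at `0` to `2T`; those at `T` are absorbed into `Compatible`.
-/
theorem reflectExt_mem_dirichletSpace {n : ℕ} {T ε : ℝ} {u : ℝ → ℝ} (hT : 0 < T)
    (hu : u ∈ sobolevW (2 * n) T) (hc : Compatible (2 * n - 1) T ε u)
    (h0 : ∀ k < n, iteratedDerivWithin (2 * k) u (Icc 0 T) 0 = 0) :
    reflectExt T ε u ∈ dirichletSpace n (2 * T) := by
  refine ⟨reflectExt_mem_sobolevW hT hu hc, fun k hk => ?_⟩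
  have hI := iteratedDerivWithin_reflectExt hT hu.1 hc (k := 2 * k) (by lia)
  rw [hI ⟨le_rfl, by linarith⟩, hI ⟨by linarith, le_rfl⟩, reflectExt_of_le hT.le,
    reflectExt_of_lt (by linarith), sub_self, h0 k hk]
  simp

/-! ### The reflected equation. -/

theorem iteratedDerivWithin_Icc_eq {a b t : ℝ} {u : ℝ → ℝ} (ht : t ∈ Ioo a b) (k : ℕ) :
    iteratedDerivWithin k u (Icc a b) t = iteratedDeriv k u t := by
  rw [iteratedDerivWithin, iteratedDeriv, ← iteratedFDerivWithin_univ,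
    iteratedFDerivWithin_congr_set (Filter.eventuallyEq_univ.2 (Icc_mem_nhds ht.1 ht.2))]

theorem diffOp_reflectExt_of_lt {m : ℕ} {T ε t : ℝ} {a : Fin m → ℝ → ℝ} {u : ℝ → ℝ}
    (ht : t ∈ Ioo 0 T) :
    diffOp (2 * T) (extendCoeff T a) (reflectExt T ε u) t = diffOp T a u t := by
  have h : ∀ k, iteratedDerivWithin k (reflectExt T ε u) (Icc 0 (2 * T)) t =
      iteratedDerivWithin k u (Icc 0 T) t := fun k => by
    rw [iteratedDerivWithin_Icc_eq ht, iteratedDerivWithin_Icc_eq ⟨ht.1, by linarith [ht.1, ht.2]⟩]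
    refine Filter.EventuallyEq.iteratedDeriv_eq k ?_
    filter_upwards [Iio_mem_nhds ht.2] with x hx using reflectExt_of_le (le_of_lt hx)
  simp only [diffOp, h, extendCoeff, if_pos ht.2.le]

/-- The factor `(-1) ^ k` from the `k`-th derivative cancels the one in `extendCoeff`. The leading
term has no coefficient to do this, hence `Even m`. -/
theorem diffOp_reflectExt_of_gt {m : ℕ} (hm : Even m) {T ε t : ℝ} {a : Fin m → ℝ → ℝ}
    {u : ℝ → ℝ} (ht : t ∈ Ioo T (2 * T)) :
    diffOp (2 * T) (extendCoeff T a) (reflectExt T ε u) t = ε * diffOp T a u (2 * T - t) := by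
  have h : ∀ k, iteratedDerivWithin k (reflectExt T ε u) (Icc 0 (2 * T)) t =
      ε * ((-1) ^ k * iteratedDerivWithin k u (Icc 0 T) (2 * T - t)) := fun k => by
    rw [iteratedDerivWithin_Icc_eq (by constructor <;> linarith [ht.1, ht.2]),
      iteratedDerivWithin_Icc_eq (by constructor <;> linarith [ht.1, ht.2])]
    have h1 : reflectExt T ε u =ᶠ[nhds t] fun x => ε * u (2 * T - x) := by
      filter_upwards [Ioi_mem_nhds ht.1] with x hx using reflectExt_of_lt hx
    rw [h1.iteratedDeriv_eq k, iteratedDeriv_const_mul_field,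
      iteratedDeriv_comp_const_sub]
    simp
  simp only [diffOp, h, extendCoeff, if_neg ht.1.not_ge, hm.neg_one_pow, one_mul, mul_add,
    Finset.mul_sum]
  congr 1
  refine Finset.sum_congr rfl fun k _ => ?_
  have : ((-1 : ℝ) ^ (k : ℕ)) * (-1) ^ (k : ℕ) = 1 := by rw [← mul_pow]; simp
  linear_combination (ε * a k (2 * T - t) *
    iteratedDerivWithin (k : ℕ) u (Icc 0 T) (2 * T - t)) * this

/-- Reflection preserves null sets. Dropping `0`, `T`, `2T` leaves interior points, where
`iteratedDerivWithin` is the ordinary derivative. -/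
theorem ae_reflect {T : ℝ} {p : ℝ → Prop} (h : ∀ᵐ t ∂(volume.restrict (Icc 0 T)), p t) :
    ∀ᵐ t ∂(volume.restrict (Icc 0 (2 * T))),
      (t ∈ Ioo 0 T ∧ p t) ∨ (t ∈ Ioo T (2 * T) ∧ p (2 * T - t)) := by
  rw [ae_restrict_iff' measurableSet_Icc] at h ⊢
  have h' := (Measure.measurePreserving_sub_left volume (2 * T)).quasiMeasurePreserving.ae h
  filter_upwards [h, h', Measure.ae_ne volume 0, Measure.ae_ne volume T,
    Measure.ae_ne volume (2 * T)] with t h1 h2 h3 h4 h5 ht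
  have h6 := lt_of_le_of_ne ht.1 (Ne.symm h3)
  have h7 := lt_of_le_of_ne ht.2 h5
  rcases lt_or_gt_of_ne h4 with h8 | h8
  · exact Or.inl ⟨⟨h6, h8⟩, h1 ⟨ht.1, h8.le⟩⟩
  · exact Or.inr ⟨⟨h8, h7⟩, h2 ⟨by linarith, by linarith⟩⟩

theorem integrableOn_reflectExt {T : ℝ} (ε : ℝ) {σ : ℝ → ℝ} (hT : 0 < T)
    (hσ : IntegrableOn σ (Icc 0 T)) : IntegrableOn (reflectExt T ε σ) (Icc 0 (2 * T)) := by
  have h1 : IntervalIntegrable σ volume 0 T :=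
    (intervalIntegrable_iff_integrableOn_Icc_of_le hT.le).2 hσ
  have h2 := ((h1.comp_sub_left (2 * T)).const_mul ε).symm
  rw [sub_zero, show 2 * T - T = T by ring] at h2
  rw [← intervalIntegrable_iff_integrableOn_Icc_of_le (by linarith)]
  refine IntervalIntegrable.trans (b := T) (h1.congr fun x hx => ?_) (h2.congr fun x hx => ?_)
  · rw [uIoc_of_le hT.le] at hx
    exact (reflectExt_of_le hx.2).symm
  · rw [uIoc_of_le (by linarith)] at hx
    exact (reflectExt_of_lt hx.1).symm

theorem isSolution_reflectExt {n : ℕ} {T ε : ℝ} {a : Fin (2 * n) → ℝ → ℝ} {X : Set (ℝ → ℝ)}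
    {σ u : ℝ → ℝ} (hu : IsSolution T a X σ u)
    (hX : reflectExt T ε u ∈ dirichletSpace n (2 * T)) :
    IsSolution (2 * T) (extendCoeff T a) (dirichletSpace n (2 * T)) (reflectExt T ε σ)
      (reflectExt T ε u) := by
  refine ⟨hX, ?_⟩
  filter_upwards [ae_reflect hu.2] with t ht
  rcases ht with ⟨ht, h⟩ | ⟨ht, h⟩
  · rw [diffOp_reflectExt_of_lt ht, h, reflectExt_of_le ht.2.le]
  · rw [diffOp_reflectExt_of_gt (even_two_mul n) ht, h, reflectExt_of_lt ht.1]

/-- Under even reflection only odd derivatives must vanish at `T`; under odd reflection, only even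
ones. -/
theorem compatible_of_mem_mixed2Space {n : ℕ} {T : ℝ} {u : ℝ → ℝ} (hn : 1 ≤ n)
    (hu : u ∈ mixed2Space n T) : Compatible (2 * n - 1) T 1 u := by
  intro k hk
  rcases Nat.even_or_odd' k with ⟨j, rfl | rfl⟩
  · simp
  · simp [(hu.2 j (by lia)).2]

theorem compatible_of_mem_dirichletSpace {n : ℕ} {T : ℝ} {u : ℝ → ℝ} (hn : 1 ≤ n)
    (hu : u ∈ dirichletSpace n T) : Compatible (2 * n - 1) T (-1) u := by
  intro k hk
  rcases Nat.even_or_odd' k with ⟨j, rfl | rfl⟩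
  · simp [(hu.2 j (by lia)).2]
  · simp [pow_succ]

theorem intervalIntegrable_green_mul {T t : ℝ} {G : ℝ → ℝ → ℝ} {σ : ℝ → ℝ} (hT : 0 ≤ T)
    (hG : ContinuousOn (fun p : ℝ × ℝ => G p.1 p.2) (Icc 0 T ×ˢ Icc 0 T))
    (hσ : IntegrableOn σ (Icc 0 T)) (ht : t ∈ Icc 0 T) :
    IntervalIntegrable (fun s => G t s * σ s) volume 0 T := by
  refine IntervalIntegrable.continuousOn_mul
    ((intervalIntegrable_iff_integrableOn_Icc_of_le hT).2 hσ) ?_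
  rw [uIcc_of_le hT]
  exact hG.comp (f := fun s => (t, s)) (by fun_prop) fun s hs => ⟨ht, hs⟩

end BVP

/-! ### Comparison through the common kernel. -/

open BVP in
theorem mainTheorem10 (n : ℕ) (hn : 1 ≤ n) (T : ℝ) (hT : 0 < T)
    (a : Fin (2 * n) → ℝ → ℝ) (ha : ∀ k, IntegrableOn (a k) (Icc 0 T))
    (hD : BVP.Nonresonant T a (BVP.dirichletSpace n T))
    (hM : BVP.Nonresonant T a (BVP.mixed2Space n T))
    (hD2 : BVP.Nonresonant (2 * T) (BVP.extendCoeff T a) (BVP.dirichletSpace n (2 * T)))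
    (G : ℝ → ℝ → ℝ)
    (hG : BVP.IsGreenFunction (2 * T) (BVP.extendCoeff T a) (BVP.dirichletSpace n (2 * T)) G)
    (σ₁ σ₂ : ℝ → ℝ) (hσ₁ : IntegrableOn σ₁ (Icc 0 T)) (hσ₂ : IntegrableOn σ₂ (Icc 0 T))
    (uM uD : ℝ → ℝ)
    (huM : BVP.IsSolution T a (BVP.mixed2Space n T) σ₁ uM)
    (huD : BVP.IsSolution T a (BVP.dirichletSpace n T) σ₂ uD) :
    ((∀ t ∈ Icc 0 (2 * T), ∀ s ∈ Icc 0 (2 * T), 0 ≤ G t s) →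
      (∀ᵐ t ∂(volume.restrict (Icc 0 T)), |σ₂ t| ≤ σ₁ t) →
      ∀ t ∈ Icc 0 T, |uD t| ≤ uM t) ∧
    ((∀ t ∈ Icc 0 (2 * T), ∀ s ∈ Icc 0 (2 * T), G t s ≤ 0) →
      (∀ᵐ t ∂(volume.restrict (Icc 0 T)), 0 ≤ σ₂ t ∧ σ₂ t ≤ σ₁ t) →
      ∀ t ∈ Icc 0 T, uM t ≤ 0 ∧ uM t ≤ uD t) ∧
    ((∀ t ∈ Icc 0 (2 * T), ∀ s ∈ Icc 0 (2 * T), G t s ≤ 0) →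
      (∀ᵐ t ∂(volume.restrict (Icc 0 T)), σ₁ t ≤ σ₂ t ∧ σ₂ t ≤ 0) →
      ∀ t ∈ Icc 0 T, 0 ≤ uM t ∧ uD t ≤ uM t) := by
  have hi₁ := integrableOn_reflectExt 1 hT hσ₁
  have hi₂ := integrableOn_reflectExt (-1) hT hσ₂
  have hT2 : (0 : ℝ) ≤ 2 * T := by linarith
  have hs₁ := (hG.isSolution_iff _ hi₁ _).1 (isSolution_reflectExt huM
    (reflectExt_mem_dirichletSpace hT huM.1.1 (compatible_of_mem_mixed2Space hn huM.1)
      fun k hk => (huM.1.2 k hk).1))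
  have hs₂ := (hG.isSolution_iff _ hi₂ _).1 (isSolution_reflectExt huD
    (reflectExt_mem_dirichletSpace hT huD.1.1 (compatible_of_mem_dirichletSpace hn huD.1)
      fun k hk => (huD.1.2 k hk).1))
  have hsub : ∀ t ∈ Icc 0 T, t ∈ Icc 0 (2 * T) := fun t ht => ⟨ht.1, by linarith [ht.2]⟩
  have eM : ∀ t ∈ Icc 0 T, uM t = ∫ s in (0 : ℝ)..2 * T, G t s * reflectExt T 1 σ₁ s :=
    fun t ht => by rw [← hs₁ t (hsub t ht), reflectExt_of_le ht.2]
  have eD : ∀ t ∈ Icc 0 T, uD t = ∫ s in (0 : ℝ)..2 * T, G t s * reflectExt T (-1) σ₂ s :=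
    fun t ht => by rw [← hs₂ t (hsub t ht), reflectExt_of_le ht.2]
  have iM := fun t ht => intervalIntegrable_green_mul hT2 hG.continuousOn hi₁ (hsub t ht)
  have iD := fun t ht => intervalIntegrable_green_mul hT2 hG.continuousOn hi₂ (hsub t ht)
  have mono : ∀ {f g : ℝ → ℝ}, IntervalIntegrable f volume 0 (2 * T) →
      IntervalIntegrable g volume 0 (2 * T) →
      (∀ᵐ s ∂(volume.restrict (Icc 0 (2 * T))), s ∈ Icc 0 (2 * T) → f s ≤ g s) →
      ∫ s in (0 : ℝ)..2 * T, f s ≤ ∫ s in (0 : ℝ)..2 * T, g s := fun hf hg h =>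
    intervalIntegral.integral_mono_ae_restrict hT2 hf hg (by
      filter_upwards [h, ae_restrict_mem measurableSet_Icc] with s h1 h2 using h1 h2)
  have i0 : IntervalIntegrable (fun _ : ℝ => (0 : ℝ)) volume 0 (2 * T) := by simp
  have z0 : ∫ _ in (0 : ℝ)..2 * T, (0 : ℝ) = 0 := by simp
  -- Any relation between the data transfers to the reflected data up to the sign of the second,
  -- which changes only beyond `T`.
  have key : ∀ {p : ℝ → ℝ → Prop},
      (∀ᵐ t ∂(volume.restrict (Icc 0 T)), p (σ₁ t) (σ₂ t)) →
      ∀ᵐ t ∂(volume.restrict (Icc 0 (2 * T))), ∃ x y, p x y ∧ reflectExt T 1 σ₁ t = x ∧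
        (reflectExt T (-1) σ₂ t = y ∨ reflectExt T (-1) σ₂ t = -y) := fun h => by
    filter_upwards [ae_reflect h] with t ht
    rcases ht with ⟨ht, h⟩ | ⟨ht, h⟩
    · exact ⟨_, _, h, reflectExt_of_le ht.2.le, Or.inl (reflectExt_of_le ht.2.le)⟩
    · exact ⟨_, _, h, by rw [reflectExt_of_lt ht.1, one_mul],
        Or.inr (by rw [reflectExt_of_lt ht.1, neg_one_mul])⟩
  refine ⟨fun hG0 hσ t ht => ?_, fun hG0 hσ t ht => ?_, fun hG0 hσ t ht => ?_⟩
  · have hk := key (p := fun x y => |y| ≤ x) hσ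
    rw [eM t ht, eD t ht, abs_le, ← intervalIntegral.integral_neg]
    refine ⟨mono (iM t ht).neg (iD t ht) ?_, mono (iD t ht) (iM t ht) ?_⟩ <;>
    · filter_upwards [hk] with s ⟨x, y, hxy, h1, h2⟩ hs
      have hg := hG0 t (hsub t ht) s hs
      rw [abs_le] at hxy
      rw [h1]
      rcases h2 with h2 | h2 <;> rw [h2] <;> nlinarith [hxy.1, hxy.2]
  -- Here `±y ≤ x`, and multiplying by `G ≤ 0` reverses the order. In the last case `x ≤ ±y`
  -- instead.
  · have hk := key (p := fun x y => 0 ≤ y ∧ y ≤ x) hσ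
    rw [eM t ht, eD t ht]
    refine ⟨(mono (iM t ht) i0 ?_).trans_eq z0, mono (iM t ht) (iD t ht) ?_⟩ <;>
    · filter_upwards [hk] with s ⟨x, y, hxy, h1, h2⟩ hs
      have hg := hG0 t (hsub t ht) s hs
      rw [h1]
      rcases h2 with h2 | h2 <;> (try rw [h2]) <;> nlinarith [hxy.1, hxy.2]
  · have hk := key (p := fun x y => x ≤ y ∧ y ≤ 0) hσ
    rw [eM t ht, eD t ht]
    refine ⟨z0.symm.trans_le (mono i0 (iM t ht) ?_), mono (iD t ht) (iM t ht) ?_⟩ <;>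
    · filter_upwards [hk] with s ⟨x, y, hxy, h1, h2⟩ hs
      have hg := hG0 t (hsub t ht) s hs
      rw [h1]
      rcases h2 with h2 | h2 <;> (try rw [h2]) <;> nlinarith [hxy.1, hxy.2]
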